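/- Let $\mathrm{cov}(\mathcal M)$ be the smallest cardinality of a cover of the real line by meager sets, and assume that $\mathrm{cov}(\mathcal M)=\mathfrak c$, the cardinality of the continuum. For a semigroup $X$, let $X^0=X\cup\{0\}$ and $X^1=X\cup\{1\}$ be the semigroups obtained by adjoining a new element $0\notin X$ with $0x=0=x0$ for all $x\in X^0$, respectively a new element $1\notin X$ with $1x=x=x1$ for all $x\in X^1$. A semigroup topology on a semigroup is a topology making its binary operation (jointly) continuous. The semigroup $X$ is called zero-closed if $X$ is a closed subset of $X^0$ for every Hausdorff semigroup topology on $X^0$. It is called polybounded if there are finitely many elements $b_1,\dots,b_m\in X$ and functions $f_1,\dots,f_m:X\to X$ such that $X=\bigcup_{i=1}^m f_i^{-1}(b_i)$ and each $f_i$ has the form $f_i(x)=a_0xa_1x\cdots xa_n$ for some $n\ge 1$ and $a_0,\dots,a_n\in X^1$ (depending on $i$). A metric $d$ on $X$ is called subinvariant if $d(axb,ayb)\le d(x,y)$ for all $x,y\in X$ and $a,b\in X^1$. Then every zero-closed semigroup $X$ satisfying at least one of the following conditions is polybounded: 1. $X$ has a separable complete subinvariant metric; 2. $X$ admits a compact Hausdorff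 semigroup topology. -/

import Mathlib

universe u

/-- `X` is zero-closed: `X` is closed in its `0`-extension `X⁰ = X ∪ {0}` (Mathlib's `WithZero X`)
endowed with any Hausdorff topology making the multiplication of `X⁰` continuous. -/
def IsZeroClosed (X : Type u) [Semigroup X] : Prop :=
  ∀ _ : TopologicalSpace (WithZero X), T2Space (WithZero X) → ContinuousMul (WithZero X) →
    IsClosed (Set.range ((↑) : X → WithZero X))

/-- The product `a₀ x a₁ x ⋯ x aₙ`, computed in the `1`-extension `X¹ = X ∪ {1}` (Mathlib's
`WithOne X`). -/
def polyEval {X : Type u} [Semigroup X] {n : ℕ} (a : Fin (n + 1) → WithOne X) (x : X) :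
    WithOne X :=
  a 0 * (List.ofFn fun i : Fin n => (x : WithOne X) * a i.succ).prod

/-- `f : X → X` is a semigroup polynomial: `f x = a₀ x a₁ x ⋯ x aₙ` for some `n ≥ 1` and
coefficients `a₀, …, aₙ ∈ X¹`. -/
def IsSemigroupPolynomial {X : Type u} [Semigroup X] (f : X → X) : Prop :=
  ∃ n : ℕ, 1 ≤ n ∧ ∃ a : Fin (n + 1) → WithOne X, ∀ x : X, (f x : WithOne X) = polyEval a x

/-- `X` is polybounded: it is the union of finitely many sets `fᵢ⁻¹(bᵢ)`, where `bᵢ ∈ X` and the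
`fᵢ` are semigroup polynomials on `X`. -/
def IsPolybounded (X : Type u) [Semigroup X] : Prop :=
  ∃ (n : ℕ) (f : Fin n → X → X) (b : Fin n → X),
    (∀ i, IsSemigroupPolynomial (f i)) ∧ ⋃ i, f i ⁻¹' {b i} = Set.univ

/-- The metric of `X` is subinvariant: `d(axb, ayb) ≤ d(x, y)` for all `x, y ∈ X` and
`a, b ∈ X¹`. Here `x'` and `y'` are the elements `axb` and `ayb` of `X`, the products being
computed in `X¹`. -/
def IsSubinvariantDist (X : Type u) [Semigroup X] [MetricSpace X] : Prop :=
  ∀ (a b : WithOne X) (x y x' y' : X),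
    (x' : WithOne X) = a * x * b → (y' : WithOne X) = a * y * b → dist x' y' ≤ dist x y

/-- `X` has a separable complete subinvariant metric. -/
def HasSeparableCompleteSubinvariantMetric (X : Type u) [Semigroup X] : Prop :=
  ∃ _ : MetricSpace X,
    TopologicalSpace.SeparableSpace X ∧ CompleteSpace X ∧ IsSubinvariantDist X

/-- `X` admits a compact Hausdorff semigroup topology. -/
def AdmitsCompactHausdorffSemigroupTopology (X : Type u) [Semigroup X] : Prop :=
  ∃ _ : TopologicalSpace X, CompactSpace X ∧ T2Space X ∧ ContinuousMul X

/-- `cov(M)`: the smallest cardinality of a cover of the real line by meager sets. -/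
noncomputable def covMeager : Cardinal.{0} :=
  sInf {κ | ∃ C : Set (Set ℝ), (∀ s ∈ C, IsMeagre s) ∧ ⋃₀ C = Set.univ ∧ Cardinal.mk C = κ}

-- Call a filter on `X` vanishing if it could be the trace of the neighborhoods of a nonisolated
-- zero in a Hausdorff semigroup topology on `X⁰`. Isolating the points of `X` turns such a filter
-- into a topology, so a zero-closed semigroup has none (`IsVanishing.not_isZeroClosed`). The proof
-- builds a vanishing filter whenever polyboundedness fails.
--
-- For a complete separable subinvariant metric there are two diagonalizations. A transfinite one
-- (`exists_cover_lt_of_forall_not_isVanishing`) shows that fewer than `𝔠` polynomial equations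
-- cover `X`. Their solution sets are closed, and `cov(M) = 𝔠` strengthens Baire's theorem to covers
-- of size below `𝔠`, so on every nonempty closed ideal some polynomial is constant on a relative
-- ball. Hence every point can be sent by a polynomial into a ball on which, within some ideal, a
-- polynomial is constant (`exists_ev_mem_ball_of_isIdeallyConstant`). If `X` is not polybounded, a
-- sequence can be chosen whose polynomial values avoid more and more of these countably many balls;
-- small neighborhoods of those values form a vanishing filter.
--
-- In the compact case, finite systems of equations have countably many shapes, the constants being
-- parameters. By compactness, finitely many real functions refute one shape for all parameters at
-- once. Countably many functions thus detect failure of polyboundedness, and they factor through a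
-- compact metric quotient, to which the metric case applies.

universe v

open Filter Topology

/-! ### Semigroup polynomials as words -/

/-- Words in a variable (`none`) and constants from `α`. -/
abbrev PolyWord (α : Type*) := FreeSemigroup (Option α)

namespace PolyWord

variable {α β M N : Type*} [Semigroup M] [Semigroup N]

/-- The list of letters of a word. -/
def letters (w : PolyWord α) : List (Option α) := w.head :: w.tail

theorem letters_injective : Function.Injective (letters : PolyWord α → List (Option α)) := by
  intro v w h
  simp only [letters, List.cons.injEq] at h
  exact FreeSemigroup.ext h.1 h.2

@[simp]
theorem letters_of (o : Option α) : letters (FreeSemigroup.of o) = [o] := rfl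

@[simp]
theorem letters_mul (v w : PolyWord α) : letters (v * w) = letters v ++ letters w := by
  simp [letters]

theorem letters_map (f : Option α → Option β) (w : PolyWord α) :
    letters (FreeSemigroup.map f w) = (letters w).map f := by
  induction w using FreeSemigroup.recOnMul with
  | ih1 o => rfl
  | ih2 o w _ ih => simp [map_mul, ih]

/-- The word contains the variable. -/
def HasVar (w : PolyWord α) : Prop := none ∈ letters w

/-- The value of a word at `x`, the constants being interpreted through `g`. -/
def ev (g : α → M) (w : PolyWord α) (x : M) : M :=
  FreeSemigroup.lift (fun o : Option α => o.elim x g) w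

/-- The word consisting of the variable. -/
def var : PolyWord α := FreeSemigroup.of none

/-- The word consisting of a constant. -/
def const (c : α) : PolyWord α := FreeSemigroup.of (some c)

@[simp]
theorem ev_var (g : α → M) (x : M) : ev g var x = x := rfl

@[simp]
theorem ev_const (g : α → M) (c : α) (x : M) : ev g (const c) x = g c := rfl

@[simp]
theorem ev_mul (g : α → M) (v w : PolyWord α) (x : M) : ev g (v * w) x = ev g v x * ev g w x := by
  simp [ev]

@[simp]
theorem hasVar_var : HasVar (var : PolyWord α) := by simp [HasVar, var]

@[simp]
theorem hasVar_mul {v w : PolyWord α} : HasVar (v * w) ↔ HasVar v ∨ HasVar w := by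
  simp [HasVar]

@[simp]
theorem not_hasVar_const (c : α) : ¬ HasVar (const c : PolyWord α) := by simp [HasVar, const]

@[elab_as_elim]
theorem induction {C : PolyWord α → Prop} (w : PolyWord α) (var : C var)
    (const : ∀ c, C (const c)) (mul : ∀ v w, C v → C w → C (v * w)) : C w := by
  induction w using FreeSemigroup.recOnMul with
  | ih1 o => cases o with
    | none => exact var
    | some c => exact const c
  | ih2 o w h ih => exact mul _ _ h ih

theorem map_ev (π : M →ₙ* N) (g : α → M) (w : PolyWord α) (x : M) :
    π (ev g w x) = ev (π ∘ g) w (π x) := by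
  induction w using induction with
  | var => rfl
  | const c => rfl
  | mul v w hv hw => simp [hv, hw]

theorem ev_map (g : β → M) (f : α → β) (w : PolyWord α) (x : M) :
    ev g (FreeSemigroup.map (Option.map f) w) x = ev (g ∘ f) w x := by
  induction w using induction with
  | var => rfl
  | const c => rfl
  | mul v w hv hw => simp [map_mul, hv, hw]

theorem ev_congr {g h : α → M} {w : PolyWord α} (H : ∀ c, some c ∈ letters w → g c = h c)
    (x : M) : ev g w x = ev h w x := by
  induction w using induction with
  | var => rfl
  | const c => exact H c (by simp [const])
  | mul v w hv hw =>
    rw [ev_mul, ev_mul, hv fun c hc => H c (by simp [hc]), hw fun c hc => H c (by simp [hc])]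

theorem hasVar_map (f : α → β) (w : PolyWord α) :
    HasVar (FreeSemigroup.map (Option.map f) w) ↔ HasVar w := by
  simp [HasVar, letters_map]

/-- Substitution of a word for the variable. -/
def subst (w p : PolyWord α) : PolyWord α :=
  FreeSemigroup.lift (fun o : Option α => o.elim p const) w

theorem ev_subst (g : α → M) (w p : PolyWord α) (x : M) :
    ev g (subst w p) x = ev g w (ev g p x) := by
  induction w using induction with
  | var => rfl
  | const c => rfl
  | mul v w hv hw =>
    have : subst (v * w) p = subst v p * subst w p := by simp [subst]
    simp [this, hv, hw]

theorem HasVar.subst {w p : PolyWord α} (hw : HasVar w) (hp : HasVar p) :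
    HasVar (subst w p) := by
  induction w using induction with
  | var => exact hp
  | const c => simp at hw
  | mul v w ihv ihw =>
    have : PolyWord.subst (v * w) p = PolyWord.subst v p * PolyWord.subst w p := by
      simp [PolyWord.subst]
    rw [this, hasVar_mul]
    exact (hasVar_mul.1 hw).imp ihv ihw

/-- Replacing the variable by the constant `x`. -/
def fix (x : α) (w : PolyWord α) : PolyWord α :=
  FreeSemigroup.map (fun o => some (o.getD x)) w

theorem ev_fix (g : α → M) (x : α) (w : PolyWord α) (y : M) :
    ev g (fix x w) y = ev g w (g x) := by
  induction w using induction with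
  | var => rfl
  | const c => rfl
  | mul v w hv hw =>
    have : fix x (v * w) = fix x v * fix x w := by simp [fix]
    simp [this, hv, hw]

theorem mem_letters_fix {x c : α} {w : PolyWord α} (h : some c ∈ letters (fix x w)) :
    c = x ∨ some c ∈ letters w := by
  rw [fix, letters_map, List.mem_map] at h
  obtain ⟨o, ho, h⟩ := h
  cases o with
  | none => left; simpa using h.symm
  | some d => right; simp at h; rwa [← h]

theorem length_letters_fix (x : α) (w : PolyWord α) :
    (letters (fix x w)).length = (letters w).length := by
  rw [fix, letters_map, List.length_map]

theorem continuous_ev [TopologicalSpace M] [ContinuousMul M] (w : PolyWord α) :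
    Continuous fun p : (α → M) × M => ev p.1 w p.2 := by
  induction w using induction with
  | var => exact continuous_snd
  | const c => exact (continuous_apply c).comp continuous_fst
  | mul v w hv hw => simp only [ev_mul]; exact hv.mul hw

theorem continuous_ev_right [TopologicalSpace M] [ContinuousMul M] (g : α → M) (w : PolyWord α) :
    Continuous fun x : M => ev g w x :=
  (continuous_ev w).comp (by fun_prop : Continuous fun x : M => (g, x))

theorem finite_setOf_length_le {S : Set α} (hS : S.Finite) (n : ℕ) :
    {w : PolyWord α | (letters w).length ≤ n ∧ ∀ c, some c ∈ letters w → c ∈ S}.Finite := by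
  let T : Set (Option α) := insert none (some '' S)
  have hT : T.Finite := (hS.image _).insert _
  have := hT.to_subtype
  refine (((List.finite_length_le T n).image (List.map Subtype.val)).preimage
    letters_injective.injOn).subset ?_
  rintro w ⟨hn, hw⟩
  have : letters w ∈ Set.range (List.map ((↑) : T → Option α)) := by
    rw [Set.range_list_map_coe]
    intro o ho
    cases o with
    | none => exact Set.mem_insert _ _
    | some c => exact Set.mem_insert_of_mem _ ⟨c, hw c ho, rfl⟩
  obtain ⟨l, hl⟩ := this
  exact ⟨l, by rw [← hl, List.length_map] at hn; exact hn, hl⟩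

open Cardinal in
theorem mk_setOf_letters_lt {S : Set α} {κ : Cardinal} (hκ : ℵ₀ < κ) (hS : #S < κ) :
    #{w : PolyWord α | ∀ c, some c ∈ letters w → c ∈ S} < κ := by
  let T : Set (Option α) := insert none (some '' S)
  have hT : #T < κ :=
    (mk_insert_le.trans (add_le_add_left mk_image_le 1)).trans_lt
      (add_lt_of_lt hκ.le hS (one_lt_aleph0.trans hκ))
  have h : #(List T) < κ := (mk_list_le_max T).trans_lt (max_lt hκ hT)
  refine (mk_image_eq (s := {w : PolyWord α | ∀ c, some c ∈ letters w → c ∈ S})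
    letters_injective).symm.trans_le ((mk_le_mk_of_subset ?_).trans
      (mk_range_le (f := List.map ((↑) : T → Option α)))) |>.trans_lt h
  rintro _ ⟨w, hw, rfl⟩
  rw [Set.range_list_map_coe]
  intro o ho
  cases o with
  | none => exact Set.mem_insert _ _
  | some c => exact Set.mem_insert_of_mem _ ⟨c, hw c ho, rfl⟩

theorem exists_polyEval {X : Type*} [Semigroup X] (l : List (Option X)) :
    ∃ (n : ℕ) (a : Fin (n + 1) → WithOne X), (none ∈ l → 1 ≤ n) ∧
      ∀ x : X, (l.map fun o => ((o.getD x : X) : WithOne X)).prod = polyEval a x := by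
  induction l with
  | nil => exact ⟨0, fun _ => 1, by simp, by simp [polyEval]⟩
  | cons o l ih =>
    obtain ⟨n, a, hn, ha⟩ := ih
    cases o with
    | none =>
      refine ⟨n + 1, Fin.cons 1 a, by simp, fun x => ?_⟩
      simp [polyEval, ha, List.ofFn_succ, mul_assoc]
    | some c =>
      refine ⟨n, Function.update a 0 (c * a 0), by simpa using hn, fun x => ?_⟩
      simp [polyEval, ha, mul_assoc]

theorem coe_ev {X : Type*} [Semigroup X] (w : PolyWord X) (x : X) :
    ((ev id w x : X) : WithOne X) =
      ((letters w).map fun o => ((o.getD x : X) : WithOne X)).prod := by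
  induction w using induction with
  | var => simp [var, ev]
  | const c => simp [const, ev]
  | mul v w hv hw => simp [hv, hw]

theorem HasVar.isSemigroupPolynomial {X : Type u} [Semigroup X] {w : PolyWord X}
    (hw : HasVar w) : IsSemigroupPolynomial (ev id w) := by
  obtain ⟨n, a, hn, ha⟩ := exists_polyEval (letters w)
  exact ⟨n, hn hw, a, fun x => by rw [coe_ev, ha]⟩

end PolyWord

open PolyWord

/-! ### Polyboundedness in terms of words, and vanishing filters -/

/-- `M` is covered by finitely many solution sets of polynomial equations. -/
def WordBounded (M : Type*) [Semigroup M] : Prop :=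
  ∃ S : Set (PolyWord M × M), S.Finite ∧ (∀ p ∈ S, HasVar p.1) ∧ ∀ x, ∃ p ∈ S, ev id p.1 x = p.2

theorem WordBounded.isPolybounded {X : Type u} [Semigroup X] (h : WordBounded X) :
    IsPolybounded X := by
  obtain ⟨S, hS, hv, hc⟩ := h
  have := hS.to_subtype
  obtain ⟨n, ⟨e⟩⟩ := Finite.exists_equiv_fin S
  refine ⟨n, fun i => ev id (e.symm i).1.1, fun i => (e.symm i).1.2,
    fun i => (hv _ (e.symm i).2).isSemigroupPolynomial, ?_⟩
  rw [Set.eq_univ_iff_forall]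
  intro x
  obtain ⟨p, hp, h⟩ := hc x
  exact Set.mem_iUnion.2 ⟨e ⟨p, hp⟩, by simpa using h⟩

/-- A filter that may serve as the trace on `M` of the neighborhood filter of a zero. -/
structure IsVanishing {M : Type*} [Semigroup M] (F : Filter M) : Prop where
  neBot : F.NeBot
  mul_left : ∀ a, Tendsto (a * ·) F F
  mul_right : ∀ a, Tendsto (· * a) F F
  mul : Tendsto (fun p : M × M => p.1 * p.2) (F ×ˢ F) F
  compl_singleton : ∀ a, {a}ᶜ ∈ F

/-- Used contrapositively: absence of vanishing filters passes to quotients. -/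
theorem IsVanishing.comap {X M : Type*} [Semigroup X] [Semigroup M] {F : Filter M}
    (hF : IsVanishing F) (π : X →ₙ* M) (hπ : Function.Surjective π) :
    IsVanishing (F.comap π) where
  neBot := hF.neBot.comap_of_surj hπ
  mul_left a := by
    rw [tendsto_comap_iff]
    exact ((hF.mul_left (π a)).comp tendsto_comap).congr fun x => by simp
  mul_right a := by
    rw [tendsto_comap_iff]
    exact ((hF.mul_right (π a)).comp tendsto_comap).congr fun x => by simp
  mul := by
    rw [tendsto_comap_iff]
    exact (hF.mul.comp (tendsto_comap.prodMap tendsto_comap)).congr fun x => by simp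
  compl_singleton a :=
    ⟨{π a}ᶜ, hF.compl_singleton _, fun x hx h => hx (by rw [Set.mem_singleton_iff.1 h]; rfl)⟩

/-- The topology on `M⁰` with isolated points in `M` and the neighborhood filter of `0` induced
by `F`. -/
@[reducible]
def vanishingTopology {M : Type*} (F : Filter M) : TopologicalSpace (WithZero M) where
  IsOpen U := 0 ∈ U → ((↑) : M → WithZero M) ⁻¹' U ∈ F
  isOpen_univ _ := univ_mem
  isOpen_inter U V hU hV h := inter_mem (hU h.1) (hV h.2)
  isOpen_sUnion S hS := by
    rintro ⟨U, hU, h⟩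
    exact mem_of_superset (hS U hU h) fun x hx => ⟨U, hU, hx⟩

theorem mem_nhds_zero_vanishing {M : Type*} {F : Filter M} {s : Set (WithZero M)} :
    s ∈ @nhds _ (vanishingTopology F) 0 ↔ 0 ∈ s ∧ ((↑) : M → WithZero M) ⁻¹' s ∈ F := by
  let _ := vanishingTopology F
  constructor
  · intro h
    obtain ⟨t, hts, ht, h0⟩ := mem_nhds_iff.1 h
    exact ⟨hts h0, mem_of_superset (ht h0) fun x hx => hts hx⟩
  · rintro ⟨h0, h⟩
    exact IsOpen.mem_nhds (fun _ => h) h0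

theorem nhds_zero_vanishing {M : Type*} (F : Filter M) :
    @nhds _ (vanishingTopology F) 0 = pure 0 ⊔ F.map ((↑) : M → WithZero M) := by
  ext s
  rw [mem_nhds_zero_vanishing]
  rfl

theorem nhds_coe_vanishing {M : Type*} (F : Filter M) (x : M) :
    @nhds _ (vanishingTopology F) (x : WithZero M) = pure (x : WithZero M) := by
  let _ := vanishingTopology F
  refine le_antisymm ?_ (pure_le_nhds _)
  rw [le_pure_iff]
  refine IsOpen.mem_nhds (fun h => ?_) rfl
  exact absurd h WithZero.zero_ne_coe

/-- With the points of `X` isolated, the multiplicative clauses of `IsVanishing` give continuity at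
`(0, 0)`, `(a, 0)` and `(0, a)`, `compl_singleton` gives the Hausdorff property, and `neBot` puts
`0` in the closure of `X`. -/
theorem IsVanishing.not_isZeroClosed {X : Type u} [Semigroup X] {F : Filter X}
    (hF : IsVanishing F) : ¬ IsZeroClosed X := by
  intro h
  let _ := vanishingTopology F
  have hsep : ∀ x : X, Disjoint (𝓝 (x : WithZero X)) (𝓝 0) := by
    intro x
    rw [nhds_coe_vanishing, ← principal_singleton, disjoint_principal_left, mem_nhds_zero_vanishing]
    refine ⟨fun h => WithZero.zero_ne_coe h, mem_of_superset (hF.compl_singleton x) ?_⟩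
    intro y hy hyx
    exact hy (WithZero.coe_inj.1 hyx)
  have h2 : T2Space (WithZero X) := by
    rw [t2Space_iff_disjoint_nhds]
    intro a b hab
    induction a using WithZero.recZeroCoe with
    | zero =>
      induction b using WithZero.recZeroCoe with
      | zero => exact absurd rfl hab
      | coe b => exact (hsep b).symm
    | coe a =>
      induction b using WithZero.recZeroCoe with
      | zero => exact hsep a
      | coe b =>
        rw [nhds_coe_vanishing, nhds_coe_vanishing, disjoint_pure_pure]
        exact hab
  have hm : ContinuousMul (WithZero X) := by
    have hz : Tendsto ((↑) : X → WithZero X) F (𝓝 0) := by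
      rw [nhds_zero_vanishing]; exact tendsto_map.mono_right le_sup_right
    refine ⟨continuous_iff_continuousAt.2 ?_⟩
    rintro ⟨a, b⟩
    rw [ContinuousAt, nhds_prod_eq]
    induction a using WithZero.recZeroCoe with
    | zero =>
      rw [zero_mul]
      induction b using WithZero.recZeroCoe with
      | zero =>
        rw [nhds_zero_vanishing, sup_prod, prod_sup, prod_sup, ← nhds_zero_vanishing,
          tendsto_sup, tendsto_sup, tendsto_sup]
        refine ⟨⟨?_, ?_⟩, ?_, ?_⟩
        · rw [prod_pure_pure, tendsto_pure_left]
          intro s hs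
          simpa using mem_of_mem_nhds hs
        · rw [pure_prod, tendsto_map'_iff]
          exact tendsto_const_nhds.congr fun x => by simp
        · rw [prod_pure, tendsto_map'_iff]
          exact tendsto_const_nhds.congr fun x => by simp
        · rw [prod_map_map_eq, tendsto_map'_iff]
          exact (hz.comp hF.mul).congr fun x => by simp
      | coe b =>
        rw [nhds_coe_vanishing, prod_pure, tendsto_map'_iff, nhds_zero_vanishing, tendsto_sup,
          ← nhds_zero_vanishing]
        constructor
        · rw [tendsto_pure_left]
          intro s hs
          simpa using mem_of_mem_nhds hs
        · rw [tendsto_map'_iff]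
          exact (hz.comp (hF.mul_right b)).congr fun x => by simp
    | coe a =>
      induction b using WithZero.recZeroCoe with
      | zero =>
        rw [mul_zero, nhds_coe_vanishing, pure_prod, tendsto_map'_iff, nhds_zero_vanishing,
          tendsto_sup, ← nhds_zero_vanishing]
        constructor
        · rw [tendsto_pure_left]
          intro s hs
          simpa using mem_of_mem_nhds hs
        · rw [tendsto_map'_iff]
          exact (hz.comp (hF.mul_left a)).congr fun x => by simp
      | coe b =>
        rw [nhds_coe_vanishing, nhds_coe_vanishing, prod_pure_pure, tendsto_pure_left]
        intro s hs
        exact mem_of_mem_nhds hs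
  have hc := (h _ h2 hm).isOpen_compl.mem_nhds (x := (0 : WithZero X))
    (by rintro ⟨x, hx⟩; exact WithZero.coe_ne_zero hx)
  rw [mem_nhds_zero_vanishing] at hc
  have := hF.neBot
  obtain ⟨x, hx⟩ := F.nonempty_of_mem hc.2
  exact hx ⟨x, rfl⟩

theorem tendsto_ev {M : Type*} [Semigroup M] {F : Filter M}
    (hl : ∀ a, Tendsto (a * ·) F F) (hr : ∀ a, Tendsto (· * a) F F)
    (hm : Tendsto (fun p : M × M => p.1 * p.2) (F ×ˢ F) F) {w : PolyWord M} (hw : HasVar w) :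
    Tendsto (ev id w) F F := by
  -- A factor of a word with a variable may have none, so the induction must also carry the constant
  -- case.
  suffices H : ∀ w : PolyWord M, (HasVar w ∧ Tendsto (ev id w) F F) ∨
      (¬ HasVar w ∧ ∃ c, ∀ x, ev id w x = c) from
    ((H w).resolve_right fun h => h.1 hw).2
  intro w
  induction w using induction with
  | var => exact .inl ⟨hasVar_var, tendsto_id⟩
  | const c => exact .inr ⟨not_hasVar_const c, c, fun x => rfl⟩
  | mul v w hv hw =>
    rcases hv with ⟨hv, tv⟩ | ⟨hv, c, hc⟩ <;> rcases hw with ⟨hw, tw⟩ | ⟨hw, d, hd⟩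
    · exact .inl ⟨hasVar_mul.2 (.inl hv), (hm.comp (tv.prodMk tw)).congr fun x => by simp⟩
    · exact .inl ⟨hasVar_mul.2 (.inl hv), ((hr d).comp tv).congr fun x => by simp [hd]⟩
    · exact .inl ⟨hasVar_mul.2 (.inr hw), ((hl c).comp tw).congr fun x => by simp [hc]⟩
    · exact .inr ⟨by simp [hv, hw], c * d, fun x => by simp [hc, hd]⟩

/-! ### Diagonal constructions of vanishing filters -/

open Cardinal in
theorem exists_forall_image_Iio {I : Type v} {M : Type u} [LinearOrder I] [WellFoundedLT I]
    (P : I → Set M → M → Prop)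
    (h : ∀ i (S : Set M), lift.{v} #S ≤ lift.{u} #(Set.Iio i) → ∃ y, P i S y) :
    ∃ x : I → M, ∀ i, P i (x '' Set.Iio i) (x i) := by
  choose y hy using h
  let x : I → M := (wellFounded_lt (α := I)).fix fun i f =>
    y i (Set.range fun j : Set.Iio i => f j j.2) mk_range_le_lift
  refine ⟨x, fun i => ?_⟩
  have hx : x i = y i (Set.range fun j : Set.Iio i => x j) mk_range_le_lift :=
    (wellFounded_lt (α := I)).fix_eq _ i
  rw [hx, Set.image_eq_range]
  exact hy i _ mk_range_le_lift

/-- Separation from `a` is only required after applying a polynomial `q`: since `q` maps the filter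
to itself, eventually `q y ∈ s`, which rules out `y = a`. The metric case needs this weaker form. -/
theorem exists_isVanishing_of_antitone {M I : Type*} [Semigroup M] [SemilatticeSup I] [Nonempty I]
    {U : I → Set M} (hU : Antitone U) (hne : ∀ i, (U i).Nonempty)
    (hl : ∀ a i, ∃ j, ∀ y ∈ U j, a * y ∈ U i) (hr : ∀ a i, ∃ j, ∀ y ∈ U j, y * a ∈ U i)
    (hm : ∀ i, ∃ j, ∀ y ∈ U j, ∀ z ∈ U j, y * z ∈ U i)
    (hs : ∀ a, ∃ q : PolyWord M, HasVar q ∧ ∃ s : Set M, ev id q a ∉ s ∧ ∃ i, U i ⊆ s) :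
    ∃ F : Filter M, IsVanishing F := by
  have hb : (⨅ i, 𝓟 (U i)).HasBasis (fun _ => True) U :=
    hasBasis_iInf_principal hU.directed_ge
  have hmul : Tendsto (fun p : M × M => p.1 * p.2) ((⨅ i, 𝓟 (U i)) ×ˢ ⨅ i, 𝓟 (U i))
      (⨅ i, 𝓟 (U i)) := by
    rw [hb.tendsto_right_iff]
    intro i _
    obtain ⟨j, hj⟩ := hm i
    filter_upwards [prod_mem_prod (hb.mem_of_mem (i := j) trivial) (hb.mem_of_mem (i := j) trivial)]
      with p hp
    exact hj _ hp.1 _ hp.2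
  have hleft : ∀ a, Tendsto (a * ·) (⨅ i, 𝓟 (U i)) (⨅ i, 𝓟 (U i)) := fun a =>
    (hb.tendsto_iff hb).2 fun i _ => (hl a i).imp fun j hj => ⟨trivial, hj⟩
  have hright : ∀ a, Tendsto (· * a) (⨅ i, 𝓟 (U i)) (⨅ i, 𝓟 (U i)) := fun a =>
    (hb.tendsto_iff hb).2 fun i _ => (hr a i).imp fun j hj => ⟨trivial, hj⟩
  refine ⟨⨅ i, 𝓟 (U i), hb.neBot_iff.2 fun {i} _ => hne i, hleft, hright, hmul, fun a => ?_⟩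
  obtain ⟨q, hq, s, has, i, hi⟩ := hs a
  filter_upwards [tendsto_ev hleft hright hmul hq (mem_of_superset (hb.mem_of_mem (i := i) trivial)
    hi)] with y hy hya
  rw [Set.mem_singleton_iff] at hya
  exact has (hya ▸ hy)

-- Enumerate `M` in order type `#M`. Fewer than `#M` equations have coefficients and right-hand side
-- among the elements enumerated or chosen so far; without a small cover, the next `x i` can violate
-- them all. The later polynomial values of the `x k` then form a base of a vanishing filter.
open Cardinal in
theorem exists_cover_lt_of_forall_not_isVanishing {M : Type u} [Semigroup M] (hM : ℵ₀ < #M)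
    (hF : ∀ F : Filter M, ¬ IsVanishing F) :
    ∃ S : Set (PolyWord M × M), #S < #M ∧ (∀ p ∈ S, HasVar p.1) ∧
      ∀ x, ∃ p ∈ S, ev id p.1 x = p.2 := by
  by_contra! hcon
  let I := (#M).ord.ToType
  have hI : #I = #M := mk_ord_toType _
  obtain ⟨a⟩ : Nonempty (I ≃ M) := Cardinal.eq.1 hI
  have hIio : ∀ i : I, #(Set.Iio i) < #M := fun i =>
    (mk_Iio_lt i (by rw [hI, Ordinal.type_toType])).trans_eq hI
  have : NoMaxOrder I := Cardinal.noMaxOrder hM.le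
  have : Nonempty I := by rw [← mk_ne_zero_iff, hI]; exact (aleph0_pos.trans hM).ne'
  obtain ⟨x, hx⟩ := exists_forall_image_Iio (I := I) (M := M)
    (fun i S y => ∀ w : PolyWord M, HasVar w →
      (∀ c, some c ∈ letters w → c ∈ a '' Set.Iio i ∪ S) → ∀ j < i, ev id w y ≠ a j) (by
    intro i S hS
    rw [lift_id, lift_id] at hS
    let W := {w : PolyWord M | ∀ c, some c ∈ letters w → c ∈ a '' Set.Iio i ∪ S}
    have hT : #(a '' Set.Iio i ∪ S : Set M) < #M :=
      (mk_union_le _ _).trans_lt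
        (add_lt_of_lt hM.le (mk_image_le.trans_lt (hIio i)) (hS.trans_lt (hIio i)))
    have hW : #W < #M := mk_setOf_letters_lt hM hT
    obtain ⟨y, hy⟩ := hcon {p | HasVar p.1 ∧ p ∈ W ×ˢ (a '' Set.Iio i)} (by
      refine (mk_le_mk_of_subset (t := W ×ˢ (a '' Set.Iio i)) fun p hp => hp.2).trans_lt ?_
      rw [mk_setProd]
      simpa using mul_lt_of_lt hM.le hW (mk_image_le.trans_lt (hIio i))) (fun p hp => hp.1)
    exact ⟨y, fun w hw hl j hj => hy (w, a j) ⟨hw, hl, j, hj, rfl⟩⟩)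
  let U : I → Set M := fun i => {y | ∃ k ≥ i, ∃ w : PolyWord M, HasVar w ∧
    (∀ c, some c ∈ letters w → c ∈ a '' Set.Iio k ∪ x '' Set.Iio k) ∧ y = ev id w (x k)}
  obtain ⟨F, h⟩ := exists_isVanishing_of_antitone (U := U) (fun i j hij y => by
      rintro ⟨k, hk, h⟩; exact ⟨k, hij.trans hk, h⟩)
    (fun i => ⟨_, i, le_rfl, var, hasVar_var, by simp [var], rfl⟩)
    (fun b i => by
      obtain ⟨j, hj⟩ := exists_gt (max i (a.symm b))
      refine ⟨j, ?_⟩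
      rintro y ⟨k, hk, w, hw, hl, rfl⟩
      refine ⟨k, (le_max_left _ _).trans (hj.le.trans hk), const b * w, hasVar_mul.2 (.inr hw),
        fun c hc => ?_, by simp⟩
      rw [letters_mul, List.mem_append] at hc
      rcases hc with hc | hc
      · simp only [const, letters_of, List.mem_singleton, Option.some.injEq] at hc
        exact .inl ⟨a.symm b, (le_max_right _ _).trans_lt (hj.trans_le hk), by simp [hc]⟩
      · exact hl c hc)
    (fun b i => by
      obtain ⟨j, hj⟩ := exists_gt (max i (a.symm b))
      refine ⟨j, ?_⟩
      rintro y ⟨k, hk, w, hw, hl, rfl⟩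
      refine ⟨k, (le_max_left _ _).trans (hj.le.trans hk), w * const b, hasVar_mul.2 (.inl hw),
        fun c hc => ?_, by simp⟩
      rw [letters_mul, List.mem_append] at hc
      rcases hc with hc | hc
      · exact hl c hc
      · simp only [const, letters_of, List.mem_singleton, Option.some.injEq] at hc
        exact .inl ⟨a.symm b, (le_max_right _ _).trans_lt (hj.trans_le hk), by simp [hc]⟩)
    (fun i => by
      have hmono : ∀ {k l : I}, k ≤ l → a '' Set.Iio k ∪ x '' Set.Iio k ⊆
          a '' Set.Iio l ∪ x '' Set.Iio l := fun h => by gcongr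
      refine ⟨i, ?_⟩
      rintro y ⟨k, hk, v, hv, hvl, rfl⟩ z ⟨l, hl, w, hw, hwl, rfl⟩
      rcases lt_trichotomy k l with h | rfl | h
      -- A product of values at two stages is a value at the later one: the earlier `x k` becomes an
      -- admissible constant there.
      · refine ⟨l, hl, fix (x k) v * w, hasVar_mul.2 (.inr hw), fun c hc => ?_, by simp [ev_fix]⟩
        rw [letters_mul, List.mem_append] at hc
        rcases hc with hc | hc
        · rcases mem_letters_fix hc with rfl | hc
          · exact .inr ⟨k, h, rfl⟩
          · exact hmono h.le (hvl c hc)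
        · exact hwl c hc
      · refine ⟨k, hk, v * w, hasVar_mul.2 (.inr hw), fun c hc => ?_, by simp⟩
        rw [letters_mul, List.mem_append] at hc
        exact hc.elim (hvl c) (hwl c)
      · refine ⟨k, hk, v * fix (x l) w, hasVar_mul.2 (.inl hv), fun c hc => ?_, by simp [ev_fix]⟩
        rw [letters_mul, List.mem_append] at hc
        rcases hc with hc | hc
        · exact hvl c hc
        · rcases mem_letters_fix hc with rfl | hc
          · exact .inr ⟨l, h, rfl⟩
          · exact hmono h.le (hwl c hc))
    (fun b => by
      refine ⟨var, hasVar_var, {b}ᶜ, by simp, ?_⟩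
      obtain ⟨j, hj⟩ := exists_gt (a.symm b)
      refine ⟨j, ?_⟩
      rintro y ⟨k, hk, w, hw, hl, rfl⟩ hb
      exact hx k w hw hl (a.symm b) (hj.trans_le hk) (by simpa using hb))
  exact hF F h

/-! ### Martin's axiom for countable posets and the strengthened Baire theorem -/

theorem floor_eq_floor_two_mul_div_two (y : ℝ) : ⌊y⌋ = ⌊2 * y⌋ / 2 := by
  have h1 := Int.floor_le y
  have h2 := Int.lt_floor_add_one y
  have h3 : 2 * ⌊y⌋ ≤ ⌊2 * y⌋ := Int.le_floor.2 (by push_cast; linarith)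
  have h4 : ⌊2 * y⌋ < 2 * ⌊y⌋ + 2 := Int.floor_lt.2 (by push_cast; linarith)
  omega

theorem floor_two_pow_mul_eq {s t : ℝ} {n i : ℕ} (hi : i ≤ n)
    (h : ⌊2 ^ n * s⌋ = ⌊2 ^ n * t⌋) : ⌊2 ^ i * s⌋ = ⌊2 ^ i * t⌋ := by
  induction n, hi using Nat.le_induction with
  | base => exact h
  | succ n _ ih =>
    apply ih
    rw [floor_eq_floor_two_mul_div_two, floor_eq_floor_two_mul_div_two (2 ^ n * t), ← mul_assoc,
      ← mul_assoc, ← pow_succ', h]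

open Classical in
/-- The descending sequence of conditions read off from the binary digits of `t`: the `n`-th
condition of the list `q` is accepted if it is below the current one and the `n`-th digit is `1`. -/
noncomputable def digitPath {P : Type*} (r : P → P → Prop) (q : ℕ → P) (p : P) (t : ℝ) : ℕ → P
  | 0 => p
  | n + 1 =>
    if Odd ⌊2 ^ n * t⌋ ∧ r (q n) (digitPath r q p t n) then q n else digitPath r q p t n

theorem digitPath_congr {P : Type*} {r : P → P → Prop} {q : ℕ → P} {p : P} {s t : ℝ} {n : ℕ}
    (h : ∀ i < n, ⌊2 ^ i * s⌋ = ⌊2 ^ i * t⌋) : digitPath r q p s n = digitPath r q p t n := by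
  induction n with
  | zero => rfl
  | succ n ih =>
    rw [digitPath, digitPath, ih fun i hi => h i (by omega), h n (by omega)]

/-- The set is nowhere dense: keep the digits of `t` up to place `n`, choose `d ∈ D` below the
condition reached, write zeros until `d` is listed at place `m`, and then a one, so that `d` is
accepted. These digits hold on a whole interval close to `t`. -/
theorem isMeagre_setOf_digitPath_notMem {P : Type*} {r : P → P → Prop} {q : ℕ → P}
    (hq : ∀ p n, ∃ m ≥ n, q m = p) (p : P) {D : Set P} (hD : ∀ p, ∃ d ∈ D, r d p) :
    IsMeagre {t | ∀ n, digitPath r q p t n ∉ D} := by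
  set A := {t | ∀ n, digitPath r q p t n ∉ D}
  refine mem_of_superset (residual_of_dense_open (s := interior Aᶜ) isOpen_interior ?_)
    interior_subset
  rw [dense_iff_inter_open]
  rintro V hV ⟨t, ht⟩
  obtain ⟨ε, hε, hball⟩ := Metric.isOpen_iff.1 hV t ht
  obtain ⟨n, hn⟩ := exists_pow_lt_of_lt_one hε (by norm_num : (1 / 2 : ℝ) < 1)
  set k := ⌊2 ^ n * t⌋ with hk
  obtain ⟨d, hd, hr⟩ := hD (digitPath r q p t (n + 1))
  obtain ⟨m, hm, rfl⟩ := hq d (n + 1)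
  obtain ⟨e, rfl⟩ := Nat.exists_eq_add_of_le hm
  set m := n + 1 + e with hm'
  -- In binary: the digits of `k`, then `e` zeros, then a one at place `m = n + 1 + e`.
  let W : Set ℝ := {s | (k * 2 ^ (1 + e) + 1 : ℝ) < 2 ^ m * s ∧ 2 ^ m * s < k * 2 ^ (1 + e) + 2}
  have hWo : IsOpen W := by
    have hcont : Continuous fun s : ℝ => 2 ^ m * s := by fun_prop
    exact (isOpen_lt continuous_const hcont).inter (isOpen_lt hcont continuous_const)
  have hfl : ∀ s ∈ W, ∀ i, n + i < m → ⌊2 ^ (n + i) * s⌋ = k * 2 ^ i := by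
    intro s hs i hi
    obtain ⟨c, hc⟩ : ∃ c, e = i + c := Nat.exists_eq_add_of_le (by omega)
    obtain ⟨h1, h2⟩ := hs
    have hp : (2 : ℝ) ^ m * s = 2 ^ (c + 1) * (2 ^ (n + i) * s) := by
      rw [hm', hc]; ring
    have hp2 : (k : ℝ) * 2 ^ (1 + e) = 2 ^ (c + 1) * (k * 2 ^ i) := by
      rw [hc]; ring
    rw [hp, hp2] at h1 h2
    have h3 : (1 : ℝ) ≤ 2 ^ c := one_le_pow₀ (by norm_num)
    rw [Int.floor_eq_iff]
    push_cast
    rw [pow_succ] at h1 h2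
    constructor
    · by_contra! h; nlinarith
    · by_contra! h; nlinarith
  have hfm : ∀ s ∈ W, ⌊2 ^ m * s⌋ = k * 2 ^ (1 + e) + 1 := by
    intro s hs
    rw [Int.floor_eq_iff]
    push_cast
    exact ⟨hs.1.le, by linarith [hs.2]⟩
  have hWA : W ⊆ Aᶜ := by
    intro s hs hsA
    have hpath : ∀ i, n + i < m → digitPath r q p s (n + i + 1) = digitPath r q p t (n + 1) := by
      intro i
      induction i with
      | zero =>
        intro _
        refine digitPath_congr fun i hi => floor_two_pow_mul_eq (n := n) (by omega) ?_
        simpa using hfl s hs 0 (by omega)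
      | succ i ih =>
        intro hi
        rw [digitPath, if_neg, ← add_assoc, ih (by omega)]
        rintro ⟨h, -⟩
        rw [hfl s hs (i + 1) hi, Int.odd_mul, pow_succ', Int.odd_mul] at h
        exact absurd h.2.1 (by decide)
    have h := hpath e (by omega)
    rw [show n + e + 1 = m by omega] at h
    apply hsA (m + 1)
    rw [digitPath, if_pos]
    · exact hd
    · rw [h, hfm s hs]
      refine ⟨?_, hr⟩
      rw [add_comm 1 e, pow_succ]
      exact ((even_two.mul_left _).mul_left _).add_one
  have hWne : (k * 2 ^ (1 + e) + 3 / 2 : ℝ) / 2 ^ m ∈ W := by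
    have : (2 : ℝ) ^ m * ((k * 2 ^ (1 + e) + 3 / 2 : ℝ) / 2 ^ m) = k * 2 ^ (1 + e) + 3 / 2 := by
      field_simp
    constructor <;> rw [this] <;> linarith
  refine ⟨_, hball ?_, interior_maximal hWA hWo hWne⟩
  have h0 := hfl _ hWne 0 (by omega)
  simp only [add_zero, pow_zero, mul_one] at h0
  generalize (k * 2 ^ (1 + e) + 3 / 2 : ℝ) / 2 ^ m = s at h0
  have habs := Int.abs_sub_lt_one_of_floor_eq_floor (h0.trans hk)
  rw [← mul_sub, abs_mul, abs_of_pos (by positivity : (0 : ℝ) < 2 ^ n)] at habs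
  rw [Metric.mem_ball, Real.dist_eq]
  refine lt_trans ?_ hn
  rw [div_pow, one_pow, lt_div_iff₀ (by positivity)]
  linarith

open Cardinal in
/-- Martin's axiom for countable posets. -/
theorem exists_generic_sequence (hcov : covMeager = continuum.{0}) {P : Type*} [Countable P]
    [Nonempty P] {r : P → P → Prop} (hr : ∀ p, r p p) {ι : Type v} (hι : #ι < continuum.{v})
    (D : ι → Set P) (hD : ∀ i p, ∃ d ∈ D i, r d p) :
    ∃ p : ℕ → P, (∀ n, r (p (n + 1)) (p n)) ∧ ∀ i, ∃ n, p n ∈ D i := by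
  obtain ⟨e, he⟩ := exists_surjective_nat P
  -- Unpairing the index lists every condition infinitely often.
  have hq : ∀ (p : P) (n : ℕ), ∃ m ≥ n, e m.unpair.1 = p := by
    intro p n
    obtain ⟨k, rfl⟩ := he p
    exact ⟨Nat.pair k n, Nat.right_le_pair _ _, by simp⟩
  obtain ⟨p₀⟩ := ‹Nonempty P›
  let q : ℕ → P := fun m => e m.unpair.1
  let A : ι → Set ℝ := fun i => {t | ∀ n, digitPath r q p₀ t n ∉ D i}
  have hA : ⋃₀ Set.range A ≠ Set.univ := by
    intro h
    have hle : covMeager ≤ #(Set.range A) := csInf_le' ⟨Set.range A, by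
      rintro _ ⟨i, rfl⟩
      exact isMeagre_setOf_digitPath_notMem hq p₀ (hD i), h, rfl⟩
    have h2 : lift.{v} #(Set.range A) ≤ lift.{0} #ι := mk_range_le_lift
    rw [lift_uzero] at h2
    have h3 := h2.trans_lt hι
    rw [lift_lt_continuum] at h3
    exact absurd h3 (by rw [← hcov]; exact hle.not_gt)
  obtain ⟨t, ht⟩ := (Set.ne_univ_iff_exists_notMem _).1 hA
  refine ⟨digitPath r q p₀ t, fun n => ?_, fun i => ?_⟩
  · rw [digitPath]
    split_ifs with h
    · exact h.2
    · exact hr _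
  · by_contra! h
    exact ht ⟨A i, ⟨i, rfl⟩, h⟩

-- Conditions are closed balls centered in a dense sequence with radii `(1/2) ^ n`. If no `C i` had
-- interior, a generic sequence of balls would miss every `C i` at some stage and shrink to a point
-- lying in none of them.
open Cardinal in
theorem exists_ball_subset_of_cover (hcov : covMeager = continuum.{0}) {Z : Type*} [MetricSpace Z]
    [CompleteSpace Z] [TopologicalSpace.SeparableSpace Z] [Nonempty Z] {ι : Type v}
    (hι : #ι < continuum.{v}) (C : ι → Set Z) (hC : ∀ i, IsClosed (C i)) (hc : ∀ z, ∃ i, z ∈ C i) :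
    ∃ i z, ∃ ε > 0, Metric.ball z ε ⊆ C i := by
  by_contra! hcon
  let a := TopologicalSpace.denseSeq Z
  have ha : DenseRange a := TopologicalSpace.denseRange_denseSeq Z
  let B : ℕ × ℕ → Set Z := fun p => Metric.closedBall (a p.1) ((1 / 2) ^ p.2)
  let r : ℕ × ℕ → ℕ × ℕ → Prop := fun q p => B q ⊆ B p ∧ p.2 ≤ q.2
  have hshrink : ∀ (p : ℕ × ℕ) (O : Set Z), IsOpen O → ∀ y ∈ Metric.ball (a p.1) ((1 / 2) ^ p.2),
      y ∈ O → ∀ n, ∃ q, r q p ∧ B q ⊆ O ∧ n ≤ q.2 := by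
    intro p O hO y hy hyO n
    obtain ⟨η, hη, hηs⟩ := Metric.isOpen_iff.1 (hO.inter Metric.isOpen_ball) y ⟨hyO, hy⟩
    obtain ⟨m, hm⟩ := exists_pow_lt_of_lt_one (half_pos hη) (by norm_num : (1 / 2 : ℝ) < 1)
    obtain ⟨j, hj⟩ := ha.exists_dist_lt y (half_pos hη)
    have hsub : B (j, max m (max n p.2)) ⊆ O ∩ Metric.ball (a p.1) ((1 / 2) ^ p.2) := by
      refine Set.Subset.trans (fun z hz => ?_) hηs
      rw [Metric.mem_closedBall] at hz
      have : (1 / 2 : ℝ) ^ (max m (max n p.2)) ≤ (1 / 2) ^ m :=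
        pow_le_pow_of_le_one (by norm_num) (by norm_num) (le_max_left _ _)
      rw [Metric.mem_ball]
      rw [dist_comm] at hj
      dsimp only at hz
      linarith [dist_triangle z (a j) y]
    exact ⟨(j, max m (max n p.2)), ⟨fun z hz => Metric.ball_subset_closedBall (hsub hz).2, by simp⟩,
      fun z hz => (hsub hz).1, by simp⟩
  have hpos : ∀ n : ℕ, (0 : ℝ) < (1 / 2) ^ n := fun n => by positivity
  obtain ⟨p, hp, hpD⟩ := exists_generic_sequence hcov (r := r) (fun p => ⟨subset_rfl, le_rfl⟩)
    (ι := ι ⊕ ℕ) (by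
      rw [mk_sum, lift_uzero]
      refine add_lt_of_lt aleph0_le_continuum (by simpa using hι) (by simp [aleph0_lt_continuum]))
    (Sum.elim (fun i => {p | B p ⊆ (C i)ᶜ}) fun n => {p | n ≤ p.2}) (by
      rintro (i | n) p
      · obtain ⟨y, hy, hyC⟩ := Set.not_subset.1 (hcon i (a p.1) _ (hpos p.2))
        obtain ⟨q, hq, hqO, -⟩ := hshrink p _ (hC i).isOpen_compl y hy hyC 0
        exact ⟨q, hqO, hq⟩
      · obtain ⟨q, hq, -, hn⟩ := hshrink p _ isOpen_univ (a p.1)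
          (Metric.mem_ball_self (hpos p.2)) trivial n
        exact ⟨q, hn, hq⟩)
  have hanti : Antitone fun n => B (p n) := antitone_nat_of_succ_le fun n => (hp n).1
  have hmono : Monotone fun n => (p n).2 := monotone_nat_of_le_succ fun n => (hp n).2
  have htop : Tendsto (fun n => (p n).2) atTop atTop :=
    tendsto_atTop_atTop_of_monotone hmono fun n => hpD (.inr n)
  obtain ⟨z, hz⟩ : (⋂ n, B (p n)).Nonempty := by
    refine Metric.nonempty_iInter_of_nonempty_biInter (fun n => Metric.isClosed_closedBall)
      (fun n => Metric.isBounded_closedBall) (fun N => ⟨a (p N).1, ?_⟩) ?_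
    · simp only [Set.mem_iInter]
      exact fun n hn => hanti hn (Metric.mem_closedBall_self (hpos _).le)
    · refine squeeze_zero (fun n => Metric.diam_nonneg)
        (fun n => Metric.diam_closedBall (hpos _).le) ?_
      have := ((tendsto_pow_atTop_nhds_zero_of_lt_one (by norm_num)
        (by norm_num : (1 / 2 : ℝ) < 1)).comp htop).const_mul 2
      simpa using this
  obtain ⟨i, hi⟩ := hc z
  obtain ⟨n, hn⟩ := hpD (.inl i)
  exact hn (Set.mem_iInter.1 hz n) hi

open Cardinal in
theorem mk_le_continuum_of_separableSpace (M : Type u) [MetricSpace M]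
    [TopologicalSpace.SeparableSpace M] : #M ≤ continuum.{u} := by
  rcases isEmpty_or_nonempty M with h | h
  · simp
  let a := TopologicalSpace.denseSeq M
  have hinj : Function.Injective fun (x : M) (n : ℕ) => dist x (a n) := by
    intro x y hxy
    by_contra hne
    obtain ⟨n, hn⟩ := (TopologicalSpace.denseRange_denseSeq M).exists_dist_lt x
      (half_pos (dist_pos.2 hne))
    have h1 : dist x (a n) = dist y (a n) := congrFun hxy n
    linarith [dist_triangle_right x y (a n)]
  have h := lift_mk_le_lift_mk_of_injective hinj
  simpa [mk_real] using h

theorem dist_mul_mul_le_add {M : Type*} [Semigroup M] [PseudoMetricSpace M]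
    (hl : ∀ a x y : M, dist (a * x) (a * y) ≤ dist x y)
    (hr : ∀ a x y : M, dist (x * a) (y * a) ≤ dist x y) (x y x' y' : M) :
    dist (x * y) (x' * y') ≤ dist x x' + dist y y' :=
  (dist_triangle _ (x' * y) _).trans (add_le_add (hr _ _ _) (hl _ _ _))

theorem continuousMul_of_dist_le {M : Type*} [Semigroup M] [PseudoMetricSpace M]
    (hl : ∀ a x y : M, dist (a * x) (a * y) ≤ dist x y)
    (hr : ∀ a x y : M, dist (x * a) (y * a) ≤ dist x y) : ContinuousMul M := by
  have : LipschitzWith 2 fun p : M × M => p.1 * p.2 := by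
    refine LipschitzWith.of_dist_le_mul fun p q => ?_
    have h := dist_mul_mul_le_add hl hr p.1 p.2 q.1 q.2
    have h1 : dist p.1 q.1 ≤ dist p q := le_max_left _ _
    have h2 : dist p.2 q.2 ≤ dist p q := le_max_right _ _
    push_cast
    linarith
  exact ⟨this.continuous⟩

open Cardinal in
theorem exists_cover_lt_continuum {M : Type u} [Semigroup M] [MetricSpace M]
    [TopologicalSpace.SeparableSpace M] (hF : ∀ F : Filter M, ¬ IsVanishing F) :
    ∃ S : Set (PolyWord M × M), #S < continuum.{u} ∧ (∀ p ∈ S, HasVar p.1) ∧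
      ∀ x, ∃ p ∈ S, ev id p.1 x = p.2 := by
  -- Below the continuum the equations `x = b` already form a small cover; only cardinality exactly
  -- `𝔠` needs the diagonal construction.
  rcases (mk_le_continuum_of_separableSpace M).lt_or_eq with h | h
  · refine ⟨Set.range fun b : M => (var, b), mk_range_le.trans_lt h, ?_, fun x => ?_⟩
    · rintro _ ⟨b, rfl⟩
      exact hasVar_var
    · exact ⟨_, ⟨x, rfl⟩, rfl⟩
  · rw [← h]
    exact exists_cover_lt_of_forall_not_isVanishing (by rw [h]; exact aleph0_lt_continuum) hF

/-! ### The complete separable metric case -/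

/-- A nonempty two-sided ideal. -/
structure IsMulIdeal {M : Type*} [Mul M] (C : Set M) : Prop where
  nonempty : C.Nonempty
  mul_left : ∀ a, ∀ c ∈ C, a * c ∈ C
  mul_right : ∀ a, ∀ c ∈ C, c * a ∈ C

theorem IsMulIdeal.ev_mem {M : Type*} [Semigroup M] {C : Set M} (hC : IsMulIdeal C)
    {w : PolyWord M} (hw : HasVar w) {x : M} (hx : x ∈ C) : ev id w x ∈ C := by
  induction w using PolyWord.induction with
  | var => exact hx
  | const c => simp at hw
  | mul v w hv hw' =>
    rw [ev_mul]
    rcases hasVar_mul.1 hw with h | h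
    · exact hC.mul_right _ _ (hv h)
    · exact hC.mul_left _ _ (hw' h)

theorem isMulIdeal_iInter_le {M : Type*} [Semigroup M] [Nonempty M] {C : ℕ → Set M}
    (hC : ∀ n, IsMulIdeal (C n)) (k : ℕ) : IsMulIdeal (⋂ n ≤ k, C n) := by
  refine ⟨?_, fun a c hc => ?_, fun a c hc => ?_⟩
  · induction k with
    | zero => simpa using (hC 0).nonempty
    | succ k ih =>
      obtain ⟨x, hx⟩ := ih
      obtain ⟨y, hy⟩ := (hC (k + 1)).nonempty
      refine ⟨x * y, ?_⟩
      simp only [Set.mem_iInter] at hx ⊢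
      intro n hn
      rcases Nat.le_succ_iff.1 hn with h | rfl
      · exact (hC n).mul_right _ _ (hx n h)
      · exact (hC _).mul_left _ _ hy
  · simp only [Set.mem_iInter] at hc ⊢
    exact fun n hn => (hC n).mul_left _ _ (hc n hn)
  · simp only [Set.mem_iInter] at hc ⊢
    exact fun n hn => (hC n).mul_right _ _ (hc n hn)

/-- Some polynomial is constant on the trace of `B` on a nonempty ideal. -/
def IsIdeallyConstant {M : Type*} [Semigroup M] (B : Set M) : Prop :=
  ∃ C : Set M, IsMulIdeal C ∧ ∃ (f : PolyWord M) (b : M), HasVar f ∧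
    ∀ y ∈ C, y ∈ B → ev id f y = b

/-- Provides a harmless filler when the ideally constant balls are listed by `ℕ`. -/
theorem IsIdeallyConstant.empty {M : Type*} [Semigroup M] [Nonempty M] :
    IsIdeallyConstant (∅ : Set M) :=
  ⟨Set.univ, ⟨Set.univ_nonempty, fun _ _ _ => trivial, fun _ _ _ => trivial⟩, var,
    Classical.arbitrary M, hasVar_var, by simp⟩

-- The exceptional points form a closed set, which is an ideal if nonempty because translations can
-- be absorbed into `q`. Covering it by fewer than `𝔠` equations makes one polynomial constant on a
-- relative ball, so that ball is ideally constant, with the exceptional set itself as the ideal.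
-- The halved radius leaves room for later approximation.
open Cardinal in
theorem exists_ev_mem_ball_of_isIdeallyConstant (hcov : covMeager = continuum.{0})
    {M : Type u} [Semigroup M] [MetricSpace M] [CompleteSpace M]
    [TopologicalSpace.SeparableSpace M]
    (hl : ∀ a x y : M, dist (a * x) (a * y) ≤ dist x y)
    (hr : ∀ a x y : M, dist (x * a) (y * a) ≤ dist x y)
    (hF : ∀ F : Filter M, ¬ IsVanishing F) {a : ℕ → M} (ha : DenseRange a) (x : M) :
    ∃ q : PolyWord M, HasVar q ∧ ∃ i m : ℕ,
      IsIdeallyConstant (Metric.ball (a i) ((1 / 2) ^ m)) ∧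
      ev id q x ∈ Metric.ball (a i) ((1 / 2) ^ m / 2) := by
  have := continuousMul_of_dist_le hl hr
  by_contra hx
  push Not at hx
  let Z : Set M := {x | ∀ q : PolyWord M, HasVar q → ∀ i m : ℕ,
      IsIdeallyConstant (Metric.ball (a i) ((1 / 2) ^ m)) →
      ev id q x ∉ Metric.ball (a i) ((1 / 2) ^ m / 2)}
  have hZ : IsMulIdeal Z := by
    refine ⟨⟨x, hx⟩, fun b c hc q hq i m him => ?_, fun b c hc q hq i m him => ?_⟩
    · have := hc (subst q (const b * var)) (hq.subst (by simp)) i m him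
      simpa [ev_subst] using this
    · have := hc (subst q (var * const b)) (hq.subst (by simp)) i m him
      simpa [ev_subst] using this
  have hZc : IsClosed Z := by
    simp only [Z, Set.ofPred_forall]
    refine isClosed_iInter fun q => isClosed_iInter fun hq => isClosed_iInter fun i =>
      isClosed_iInter fun m => isClosed_iInter fun him => ?_
    exact (Metric.isOpen_ball.preimage (continuous_ev_right id q)).isClosed_compl
  obtain ⟨S, hS, hSv, hSc⟩ := exists_cover_lt_continuum hF
  have : CompleteSpace Z := hZc.completeSpace_coe
  have : Nonempty Z := hZ.nonempty.to_subtype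
  have : SecondCountableTopology M := UniformSpace.secondCountable_of_separable M
  obtain ⟨p, z, ε, hε, hball⟩ := exists_ball_subset_of_cover hcov (Z := Z) (ι := S) hS
    (fun p => {z : Z | ev id p.1.1 (z : M) = p.1.2})
    (fun p => isClosed_eq ((continuous_ev_right id _).comp continuous_subtype_val)
      continuous_const)
    (fun z => by
      obtain ⟨p, hp, h⟩ := hSc z
      exact ⟨⟨p, hp⟩, h⟩)
  obtain ⟨m, hm⟩ := exists_pow_lt_of_lt_one (half_pos hε) (by norm_num : (1 / 2 : ℝ) < 1)
  have hpos : (0 : ℝ) < (1 / 2) ^ m := by positivity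
  obtain ⟨i, hi⟩ := ha.exists_dist_lt (z : M) (half_pos hpos)
  -- The variable itself puts `z` in the half ball, against `z ∈ Z`. The full ball around `a i` lies
  -- within `ε` of `z`, since `(3/2) * (1/2) ^ m < ε`.
  refine z.2 var hasVar_var i m ⟨Z, hZ, p.1.1, p.1.2, hSv _ p.2, fun y hy hyB => ?_⟩ hi
  refine hball (a := ⟨y, hy⟩) ?_
  rw [Metric.mem_ball] at hyB ⊢
  rw [Subtype.dist_eq]
  linarith [dist_triangle_right y z (a i)]

/-- At stage `k` take `z` in the intersection of the ideals for `j ≤ k`. Then `w (z * x)` stays in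
these ideals, so `w (z * x) ∈ B j` forces the equation `f j (w (z * x)) = b j`. Only finitely many
equations arise, so some `z * x` is admissible. -/
theorem exists_forall_ev_notMem_of_not_wordBounded {M : Type u} [Semigroup M] [Nonempty M]
    (hM : ¬ WordBounded M) {B : ℕ → Set M} (hB : ∀ n, IsIdeallyConstant (B n)) (a : ℕ → M) :
    ∃ x : ℕ → M, ∀ k, ∀ w : PolyWord M, HasVar w → (letters w).length ≤ 2 ^ k →
      (∀ c, some c ∈ letters w → c ∈ a '' Set.Iic k ∪ x '' Set.Iio k) →
      ∀ j ≤ k, ev id w (x k) ∉ B j := by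
  choose C hC f b hf hCB using hB
  refine exists_forall_image_Iio (fun k S y => ∀ w : PolyWord M, HasVar w →
    (letters w).length ≤ 2 ^ k → (∀ c, some c ∈ letters w → c ∈ a '' Set.Iic k ∪ S) →
      ∀ j ≤ k, ev id w y ∉ B j) fun k S hS => ?_
  have hSf : S.Finite := by
    rw [← Set.finite_coe_iff, ← Cardinal.mk_lt_aleph0_iff, ← Cardinal.lift_lt_aleph0.{u, 0}]
    refine hS.trans_lt ?_
    rw [Cardinal.lift_lt_aleph0, Cardinal.mk_lt_aleph0_iff]
    infer_instance
  have hT : (a '' Set.Iic k ∪ S).Finite := ((Set.finite_Iic k).image a).union hSf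
  have hW := finite_setOf_length_le hT (2 ^ k)
  obtain ⟨z, hz⟩ := (isMulIdeal_iInter_le hC k).nonempty
  by_contra! hcon
  apply hM
  refine ⟨(fun p : PolyWord M × ℕ =>
      (subst (f p.2) (subst p.1 (const z * var)), b p.2)) ''
      {p | HasVar p.1 ∧ p ∈ {w : PolyWord M | (letters w).length ≤ 2 ^ k ∧
        ∀ c, some c ∈ letters w → c ∈ a '' Set.Iic k ∪ S} ×ˢ Set.Iic k}, ?_, ?_, fun x => ?_⟩
  · exact ((hW.prod (Set.finite_Iic k)).subset fun p hp => hp.2).image _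
  · rintro _ ⟨p, hp, rfl⟩
    exact (hf _).subst (hp.1.subst (by simp))
  · obtain ⟨w, hw, hwl, hwS, j, hj, h⟩ := hcon (z * x)
    refine ⟨_, ⟨(w, j), ⟨hw, ⟨hwl, hwS⟩, hj⟩, rfl⟩, ?_⟩
    simp only [ev_subst]
    refine hCB j _ ((hC j).ev_mem hw ?_) h
    exact (hC j).mul_right _ _ (Set.mem_iInter₂.1 hz j hj)

theorem wordBounded_of_complete_separable (hcov : covMeager = Cardinal.continuum.{0})
    {M : Type u} [Semigroup M] [MetricSpace M] [CompleteSpace M]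
    [TopologicalSpace.SeparableSpace M]
    (hl : ∀ a x y : M, dist (a * x) (a * y) ≤ dist x y)
    (hr : ∀ a x y : M, dist (x * a) (y * a) ≤ dist x y)
    (hF : ∀ F : Filter M, ¬ IsVanishing F) : WordBounded M := by
  rcases isEmpty_or_nonempty M with hM | hM
  · exact ⟨∅, Set.finite_empty, by simp, fun x => isEmptyElim x⟩
  by_contra hWB
  let a := TopologicalSpace.denseSeq M
  have ha : DenseRange a := TopologicalSpace.denseRange_denseSeq M
  classical
  let B : ℕ → Set M := fun n =>
    if IsIdeallyConstant (Metric.ball (a n.unpair.1) ((1 / 2) ^ n.unpair.2)) then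
      Metric.ball (a n.unpair.1) ((1 / 2) ^ n.unpair.2) else ∅
  have hB : ∀ n, IsIdeallyConstant (B n) := by
    intro n
    simp only [B]
    split_ifs with h
    · exact h
    · exact .empty
  obtain ⟨x, hx⟩ := exists_forall_ev_notMem_of_not_wordBounded hWB hB a
  -- A larger `n` tightens the budget: one multiplication at most doubles the length, which costs
  -- one step in `n`. The tolerance `(1/2) ^ n` in `U` lets dense coefficients replace arbitrary
  -- ones.
  let A : ℕ → ℕ → Set (PolyWord M) := fun k n => {w | HasVar w ∧ (letters w).length ≤ 2 ^ (k - n) ∧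
    ∀ c, some c ∈ letters w → c ∈ a '' Set.Iic (k - n) ∪ x '' Set.Iio k}
  let U : ℕ → Set M := fun n => {y | ∃ k ≥ n, ∃ w ∈ A k n, dist y (ev id w (x k)) < (1 / 2) ^ n}
  have hAmono : ∀ {k l n m : ℕ}, k ≤ l → m ≤ n → a '' Set.Iic (k - n) ∪ x '' Set.Iio k ⊆
      a '' Set.Iic (l - m) ∪ x '' Set.Iio l := fun h h' => by gcongr
  have hhalf : ∀ n : ℕ, (1 / 2 : ℝ) ^ (n + 1) = (1 / 2) ^ n / 2 := fun n => by ring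
  have hhalf_le : ∀ {n m : ℕ}, n ≤ m → (1 / 2 : ℝ) ^ m ≤ (1 / 2) ^ n := fun h =>
    pow_le_pow_of_le_one (by norm_num) (by norm_num) h
  have hpos : ∀ n : ℕ, (0 : ℝ) < (1 / 2) ^ n := fun n => by positivity
  have hUanti : Antitone U := by
    rintro n m hnm y ⟨k, hk, w, ⟨hw, hwl, hwS⟩, hd⟩
    refine ⟨k, hnm.trans hk, w, ⟨hw, hwl.trans (Nat.pow_le_pow_right (by norm_num) (by omega)),
      fun c hc => hAmono le_rfl hnm (hwS c hc)⟩, hd.trans_le (hhalf_le hnm)⟩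
  -- Words of budget `n + 1` can be multiplied by a word with controlled letters.
  have hA : ∀ {k n : ℕ} {v w : PolyWord M}, n + 1 ≤ k → (HasVar v ∨ HasVar w) →
      (letters v).length ≤ 2 ^ (k - (n + 1)) → (letters w).length ≤ 2 ^ (k - (n + 1)) →
      (∀ c, some c ∈ letters v → c ∈ a '' Set.Iic (k - n) ∪ x '' Set.Iio k) →
      (∀ c, some c ∈ letters w → c ∈ a '' Set.Iic (k - n) ∪ x '' Set.Iio k) →
      v * w ∈ A k n := by
    intro k n v w hk hvw hv hw hvS hwS
    refine ⟨hasVar_mul.2 hvw, ?_, fun c hc => ?_⟩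
    · rw [letters_mul, List.length_append, show k - n = k - (n + 1) + 1 by omega, pow_succ]
      omega
    · rw [letters_mul, List.mem_append] at hc
      exact hc.elim (hvS c) (hwS c)
  have hconst : ∀ {i k n : ℕ}, n + i ≤ k → ∀ c, some c ∈ letters (const (a i)) →
      c ∈ a '' Set.Iic (k - n) ∪ x '' Set.Iio k := by
    intro i k n h c hc
    simp only [const, letters_of, List.mem_singleton, Option.some.injEq] at hc
    exact .inl ⟨i, Set.mem_Iic.2 (by omega), hc.symm⟩
  have hmul := dist_mul_mul_le_add hl hr
  obtain ⟨F, h⟩ := exists_isVanishing_of_antitone (U := U) hUanti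
    (fun n => ⟨x n, n, le_rfl, var, ⟨hasVar_var, by simp [var], by simp [var]⟩, by simp⟩)
    (fun b n => by
      obtain ⟨i, hi⟩ := ha.exists_dist_lt b (hpos (n + 1))
      -- The `1` halves the tolerance, leaving half for replacing `b` by `a i`; the `i` ensures `i ≤
      -- k - n`, so that `a i` is an allowed constant.
      refine ⟨n + 1 + i, ?_⟩
      rintro y ⟨k, hk, w, ⟨hw, hwl, hwS⟩, hd⟩
      refine ⟨k, by omega, const (a i) * w, hA (by omega) (.inr hw) ?_
        (hwl.trans (Nat.pow_le_pow_right (by norm_num) (by omega))) (hconst (by omega))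
        (fun c hc => hAmono le_rfl (by omega) (hwS c hc)), ?_⟩
      · simpa [const] using Nat.one_le_two_pow
      · rw [ev_mul, ev_const, id]
        have := hmul b y (a i) (ev id w (x k))
        have h2 : (1 / 2 : ℝ) ^ (n + 1 + i) ≤ (1 / 2) ^ (n + 1) := hhalf_le (by omega)
        rw [hhalf] at hi h2
        linarith)
    (fun b n => by
      obtain ⟨i, hi⟩ := ha.exists_dist_lt b (hpos (n + 1))
      refine ⟨n + 1 + i, ?_⟩
      rintro y ⟨k, hk, w, ⟨hw, hwl, hwS⟩, hd⟩
      refine ⟨k, by omega, w * const (a i), hA (by omega) (.inl hw)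
        (hwl.trans (Nat.pow_le_pow_right (by norm_num) (by omega))) ?_
        (fun c hc => hAmono le_rfl (by omega) (hwS c hc)) (hconst (by omega)), ?_⟩
      · simpa [const] using Nat.one_le_two_pow
      · rw [ev_mul, ev_const, id]
        have := hmul y b (ev id w (x k)) (a i)
        have h2 : (1 / 2 : ℝ) ^ (n + 1 + i) ≤ (1 / 2) ^ (n + 1) := hhalf_le (by omega)
        rw [hhalf] at hi h2
        linarith)
    (fun n => by
      refine ⟨n + 1, ?_⟩
      rintro y ⟨k, hk, v, ⟨hv, hvl, hvS⟩, hdv⟩ z ⟨l, hl', w, ⟨hw, hwl, hwS⟩, hdw⟩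
      have hd := hmul y z (ev id v (x k)) (ev id w (x l))
      rw [hhalf] at hdv hdw
      have hd' : dist (y * z) (ev id v (x k) * ev id w (x l)) < (1 / 2) ^ n := by linarith
      rcases lt_trichotomy k l with h | rfl | h
      · refine ⟨l, by omega, fix (x k) v * w, hA hl' (.inr hw) ?_ hwl (fun c hc => ?_)
          (fun c hc => hAmono le_rfl (by omega) (hwS c hc)), by simpa [ev_fix] using hd'⟩
        · rw [length_letters_fix]
          exact hvl.trans (Nat.pow_le_pow_right (by norm_num) (by omega))
        · rcases mem_letters_fix hc with rfl | hc
          · exact .inr ⟨k, h, rfl⟩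
          · exact hAmono h.le (by omega) (hvS c hc)
      · exact ⟨k, by omega, v * w, hA hk (.inr hw) hvl hwl
          (fun c hc => hAmono le_rfl (by omega) (hvS c hc))
          (fun c hc => hAmono le_rfl (by omega) (hwS c hc)), by simpa using hd'⟩
      · refine ⟨k, by omega, v * fix (x l) w, hA hk (.inl hv) hvl ?_
          (fun c hc => hAmono le_rfl (by omega) (hvS c hc)) (fun c hc => ?_),
          by simpa [ev_fix] using hd'⟩
        · rw [length_letters_fix]
          exact hwl.trans (Nat.pow_le_pow_right (by norm_num) (by omega))
        · rcases mem_letters_fix hc with rfl | hc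
          · exact .inr ⟨l, h, rfl⟩
          · exact hAmono h.le (by omega) (hwS c hc))
    (fun b => by
      obtain ⟨q, hq, i, m, him, hball⟩ :=
        exists_ev_mem_ball_of_isIdeallyConstant hcov hl hr hF ha b
      -- The summand `Nat.pair i m` brings the ball into the list avoided at stage `k`; `m + 1`
      -- keeps the tolerance within half its radius, so a point of the half ball would put `ev id w
      -- (x k)` in the full ball.
      refine ⟨q, hq, (Metric.ball (a i) ((1 / 2) ^ m / 2))ᶜ, not_not.2 hball,
        Nat.pair i m + (m + 1), ?_⟩
      rintro y ⟨k, hk, w, ⟨hw, hwl, hwS⟩, hd⟩ hy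
      refine hx k w hw (hwl.trans (Nat.pow_le_pow_right (by norm_num) (by omega)))
        (fun c hc => hAmono (n := _) (m := 0) le_rfl (Nat.zero_le _) (hwS c hc))
        (Nat.pair i m) (by omega) ?_
      simp only [B, Nat.unpair_pair, if_pos him]
      rw [Metric.mem_ball] at hy ⊢
      have h2 : (1 / 2 : ℝ) ^ (Nat.pair i m + (m + 1)) ≤ (1 / 2) ^ (m + 1) := hhalf_le (by omega)
      rw [hhalf] at h2
      linarith [dist_triangle_left (ev id w (x k)) (a i) y])
  exact hF F h

/-! ### The compact case -/

/-- Separates the shape `σ` of a finite system, of which there are countably many, from its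
parameters `g`, which range over a power of `M`. -/
theorem WordBounded.exists_list {M : Type*} [Semigroup M] [Nonempty M] (h : WordBounded M) :
    ∃ (σ : List (PolyWord ℕ × ℕ)) (g : ℕ → M), (∀ p ∈ σ, HasVar p.1) ∧
      ∀ x, ∃ p ∈ σ, ev g p.1 x = g p.2 := by
  obtain ⟨S, hS, hv, hc⟩ := h
  let T : Set M := ⋃ p ∈ S, insert p.2 {c | some c ∈ letters p.1}
  have hT : T.Countable := by
    refine hS.countable.biUnion fun p _ => Set.Countable.insert _ ?_
    exact ((List.finite_toSet (letters p.1)).preimage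
      (Option.some_injective M).injOn).countable
  obtain ⟨g, hg⟩ := (hT.insert (Classical.arbitrary M)).exists_eq_range (Set.insert_nonempty _ _)
  have hidx : ∀ c ∈ T, g (Function.invFun g c) = c := fun c hc =>
    Function.invFun_eq (show c ∈ Set.range g from hg ▸ Set.mem_insert_of_mem _ hc)
  refine ⟨hS.toFinset.toList.map fun p =>
    (FreeSemigroup.map (Option.map (Function.invFun g)) p.1, Function.invFun g p.2), g, ?_,
    fun x => ?_⟩
  · intro p hp
    obtain ⟨q, hq, rfl⟩ := List.mem_map.1 hp
    exact (hasVar_map _ _).2 (hv q (by simpa using hq))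
  · obtain ⟨p, hp, h⟩ := hc x
    refine ⟨_, List.mem_map.2 ⟨p, by simpa using hp, rfl⟩, ?_⟩
    rw [ev_map, hidx p.2 (Set.mem_biUnion hp (Set.mem_insert _ _)), ← h]
    exact ev_congr (fun c hc => hidx c (Set.mem_biUnion hp (Set.mem_insert_of_mem _ hc))) x

theorem wordBounded_of_list {M : Type*} [Semigroup M] {σ : List (PolyWord ℕ × ℕ)} {g : ℕ → M}
    (hσ : ∀ p ∈ σ, HasVar p.1) (h : ∀ x, ∃ p ∈ σ, ev g p.1 x = g p.2) : WordBounded M := by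
  refine ⟨(fun p : PolyWord ℕ × ℕ => (FreeSemigroup.map (Option.map g) p.1, g p.2)) '' {p | p ∈ σ},
    (List.finite_toSet σ).image _, ?_, fun x => ?_⟩
  · rintro _ ⟨p, hp, rfl⟩
    exact (hasVar_map _ _).2 (hσ p hp)
  · obtain ⟨p, hp, h⟩ := h x
    exact ⟨_, ⟨p, hp, rfl⟩, by rw [ev_map]; exact h⟩

/-- Apply the metric case to the separation quotient and lift the parameters along a section;
equality in the quotient becomes distance zero. -/
theorem exists_list_dist_eq_zero (hcov : covMeager = Cardinal.continuum.{0}) {X : Type u}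
    [Semigroup X] [PseudoMetricSpace X] [CompactSpace X] [Nonempty X]
    (hl : ∀ a x y : X, dist (a * x) (a * y) ≤ dist x y)
    (hr : ∀ a x y : X, dist (x * a) (y * a) ≤ dist x y)
    (hF : ∀ F : Filter X, ¬ IsVanishing F) :
    ∃ (σ : List (PolyWord ℕ × ℕ)) (g : ℕ → X), (∀ p ∈ σ, HasVar p.1) ∧
      ∀ x, ∃ p ∈ σ, dist (ev g p.1 x) (g p.2) = 0 := by
  have := continuousMul_of_dist_le hl hr
  have : CompactSpace (SeparationQuotient X) := Quotient.compactSpace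
  have : TopologicalSpace.SeparableSpace (SeparationQuotient X) :=
    have : SecondCountableTopology (SeparationQuotient X) :=
      EMetric.secondCountable_of_sigmaCompact _
    inferInstance
  let π : X →ₙ* SeparationQuotient X := ⟨SeparationQuotient.mk, SeparationQuotient.mk_mul⟩
  have hπ : Function.Surjective π := SeparationQuotient.surjective_mk
  have hdist : ∀ x y : X, dist (π x) (π y) = dist x y := SeparationQuotient.dist_mk
  obtain ⟨σ, g, hσ, h⟩ := (wordBounded_of_complete_separable hcov (M := SeparationQuotient X)
    (by
      intro a x y
      obtain ⟨a, rfl⟩ := hπ a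
      obtain ⟨x, rfl⟩ := hπ x
      obtain ⟨y, rfl⟩ := hπ y
      simpa only [← map_mul, hdist] using hl a x y)
    (by
      intro a x y
      obtain ⟨a, rfl⟩ := hπ a
      obtain ⟨x, rfl⟩ := hπ x
      obtain ⟨y, rfl⟩ := hπ y
      simpa only [← map_mul, hdist] using hr a x y)
    (fun F h => hF _ (h.comap π hπ))).exists_list
  choose s hs using hπ
  have hg : g = π ∘ s ∘ g := funext fun n => (hs _).symm
  refine ⟨σ, s ∘ g, hσ, fun x => ?_⟩
  obtain ⟨p, hp, h⟩ := h (π x)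
  refine ⟨p, hp, ?_⟩
  rw [← hdist, map_ev, ← hg, h, Function.comp_apply, hs, dist_self]

/-- Every continuous map from a compact semigroup to a metric space factors through a compact
subinvariant pseudometric. -/
theorem exists_pseudoMetricSpace_subinvariant {X E : Type*} [Semigroup X] [TopologicalSpace X]
    [CompactSpace X] [ContinuousMul X] [MetricSpace E] (φ : C(X, E)) :
    ∃ d : PseudoMetricSpace X, @CompactSpace X d.toUniformSpace.toTopologicalSpace ∧
      (∀ a x y : X, dist (a * x) (a * y) ≤ dist x y) ∧
      (∀ a x y : X, dist (x * a) (y * a) ≤ dist x y) ∧ ∀ x y : X, dist x y = 0 → φ x = φ y := by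
  let L : C(X, C(X, E)) := (φ.comp ⟨fun p : X × X => p.2 * p.1, by fun_prop⟩).curry
  let R : C(X, C(X, E)) := (φ.comp ⟨fun p : X × X => p.1 * p.2, by fun_prop⟩).curry
  let T : C(X, C(X × X, E)) :=
    (φ.comp ⟨fun p : X × (X × X) => p.2.1 * p.1 * p.2.2, by fun_prop⟩).curry
  -- The induced distance is the supremum of `dist (φ (axb)) (φ (ayb))` over `a, b ∈ X¹`, the four
  -- coordinates being the cases where each of `a, b` is or is not `1`. Translations only shrink the
  -- family over which it is taken.
  let Φ : X → E × C(X, E) × C(X, E) × C(X × X, E) := fun x => (φ x, L x, R x, T x)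
  have hΦ : Continuous Φ := by fun_prop
  let d : PseudoMetricSpace X := PseudoMetricSpace.induced Φ inferInstance
  have hL : ∀ x a, L x a = φ (a * x) := fun _ _ => rfl
  have hR : ∀ x a, R x a = φ (x * a) := fun _ _ => rfl
  have hT : ∀ x a b, T x (a, b) = φ (a * x * b) := fun _ _ _ => rfl
  have h0 : ∀ x y : X, dist (φ x) (φ y) ≤ d.dist x y := fun x y => le_max_left _ _
  have h1 : ∀ x y a : X, dist (φ (a * x)) (φ (a * y)) ≤ d.dist x y := fun x y a =>
    (ContinuousMap.dist_apply_le_dist (f := L x) (g := L y) a).trans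
      ((le_max_left _ _).trans (le_max_right _ _))
  have h2 : ∀ x y a : X, dist (φ (x * a)) (φ (y * a)) ≤ d.dist x y := fun x y a =>
    (ContinuousMap.dist_apply_le_dist (f := R x) (g := R y) a).trans
      ((le_max_left _ _).trans ((le_max_right _ _).trans (le_max_right _ _)))
  have h3 : ∀ x y a b : X, dist (φ (a * x * b)) (φ (a * y * b)) ≤ d.dist x y := fun x y a b =>
    (ContinuousMap.dist_apply_le_dist (f := T x) (g := T y) (a, b)).trans
      ((le_max_right _ _).trans ((le_max_right _ _).trans (le_max_right _ _)))
  have hle : ∀ (x y : X) (r : ℝ), dist (φ x) (φ y) ≤ r →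
      (∀ a, dist (φ (a * x)) (φ (a * y)) ≤ r) → (∀ a, dist (φ (x * a)) (φ (y * a)) ≤ r) →
      (∀ a b, dist (φ (a * x * b)) (φ (a * y * b)) ≤ r) → d.dist x y ≤ r := by
    intro x y r g0 g1 g2 g3
    have hr := dist_nonneg.trans g0
    exact max_le g0 (max_le ((ContinuousMap.dist_le hr).2 g1) (max_le
      ((ContinuousMap.dist_le hr).2 g2) ((ContinuousMap.dist_le hr).2 fun p => g3 p.1 p.2)))
  refine ⟨d, ?_, fun a x y => ?_, fun a x y => ?_, fun x y h => ?_⟩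
  · have hid : Continuous[_, d.toUniformSpace.toTopologicalSpace] (id : X → X) :=
      continuous_induced_rng.2 hΦ
    have := @IsCompact.image X X _ d.toUniformSpace.toTopologicalSpace _ _ isCompact_univ hid
    rw [Set.image_id] at this
    exact @CompactSpace.mk X d.toUniformSpace.toTopologicalSpace this
  · refine hle _ _ _ (h1 x y a) (fun b => ?_) (fun b => h3 x y a b) fun b c => ?_
    · simpa only [mul_assoc] using h1 x y (b * a)
    · simpa only [mul_assoc] using h3 x y (b * a) c
  · refine hle _ _ _ (h2 x y a) (fun b => ?_) (fun b => ?_) fun b c => ?_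
    · simpa only [mul_assoc] using h3 x y b a
    · simpa only [mul_assoc] using h2 x y (a * b)
    · simpa only [mul_assoc] using h3 x y b (a * c)
  · exact dist_le_zero.1 ((h0 x y).trans h.le)

/-- The parameters `g` refuted by a given finite set of functions form an open subset of the compact
space `ℕ → X`, increasing with that set, so one finite set refutes them all. -/
theorem exists_finset_separating {X : Type*} [Semigroup X] [TopologicalSpace X] [CompactSpace X]
    [T2Space X] [ContinuousMul X] {σ : List (PolyWord ℕ × ℕ)}
    (hσ : ∀ g : ℕ → X, ∃ x, ∀ p ∈ σ, ev g p.1 x ≠ g p.2) :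
    ∃ A : Finset C(X, ℝ), ∀ g : ℕ → X, ∃ x, ∀ p ∈ σ, ∃ φ ∈ A, φ (ev g p.1 x) ≠ φ (g p.2) := by
  classical
  have hsep : ∀ y z : X, ∃ φ : C(X, ℝ), y ≠ z → φ y ≠ φ z := by
    intro y z
    by_cases h : y = z
    · exact ⟨0, fun h' => absurd h h'⟩
    · obtain ⟨φ, h0, h1, -⟩ := exists_continuous_zero_one_of_isClosed (isClosed_singleton (x := y))
        (isClosed_singleton (x := z)) (Set.disjoint_singleton.2 h)
      refine ⟨φ, fun _ => ?_⟩
      rw [h0 rfl, h1 rfl]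
      exact zero_ne_one
  choose s hs using hsep
  let U : Finset C(X, ℝ) → Set (ℕ → X) := fun A =>
    ⋃ x, ⋂ p ∈ {p | p ∈ σ}, ⋃ φ ∈ A, {g | φ (ev g p.1 x) ≠ φ (g p.2)}
  have hUo : ∀ A, IsOpen (U A) := by
    intro A
    refine isOpen_iUnion fun x => (List.finite_toSet σ).isOpen_biInter fun p _ =>
      isOpen_biUnion fun φ _ => isOpen_ne_fun ?_ ?_
    · exact φ.continuous.comp ((continuous_ev p.1).comp (continuous_id.prodMk continuous_const))
    · fun_prop
  have hmem : ∀ A g, g ∈ U A ↔ ∃ x, ∀ p ∈ σ, ∃ φ ∈ A, φ (ev g p.1 x) ≠ φ (g p.2) := by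
    intro A g
    simp [U]
  have hmono : Monotone U := by
    intro A B hAB g hg
    rw [hmem] at hg ⊢
    obtain ⟨x, hx⟩ := hg
    exact ⟨x, fun p hp => (hx p hp).imp fun φ h => ⟨hAB h.1, h.2⟩⟩
  obtain ⟨A, hA⟩ := isCompact_univ.elim_directed_cover U hUo (by
    intro g _
    obtain ⟨x, hx⟩ := hσ g
    refine Set.mem_iUnion.2 ⟨(σ.map fun p => s (ev g p.1 x) (g p.2)).toFinset, ?_⟩
    rw [hmem]
    exact ⟨x, fun p hp => ⟨s (ev g p.1 x) (g p.2),
      List.mem_toFinset.2 (List.mem_map.2 ⟨p, hp, rfl⟩), hs _ _ (hx p hp)⟩⟩) hmono.directed_le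
  exact ⟨A, fun g => (hmem A g).1 (hA trivial)⟩

theorem FreeSemigroup.countable {α : Type*} [Countable α] : Countable (FreeSemigroup α) :=
  Function.Injective.countable (f := fun w : FreeSemigroup α => (w.head, w.tail))
    fun _ _ h => FreeSemigroup.ext (congrArg Prod.fst h) (congrArg Prod.snd h)

theorem wordBounded_of_compact (hcov : covMeager = Cardinal.continuum.{0}) {X : Type u}
    [Semigroup X] [TopologicalSpace X] [CompactSpace X] [T2Space X] [ContinuousMul X]
    (hF : ∀ F : Filter X, ¬ IsVanishing F) : WordBounded X := by
  rcases isEmpty_or_nonempty X with hX | hX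
  · exact ⟨∅, Set.finite_empty, by simp, fun x => isEmptyElim x⟩
  by_contra hWB
  have hex : ∀ σ : List (PolyWord ℕ × ℕ), ∃ A : Finset C(X, ℝ), (∀ p ∈ σ, HasVar p.1) →
      ∀ g : ℕ → X, ∃ x, ∀ p ∈ σ, ∃ φ ∈ A, φ (ev g p.1 x) ≠ φ (g p.2) := by
    intro σ
    by_cases hσ : ∀ p ∈ σ, HasVar p.1
    · obtain ⟨A, hA⟩ := exists_finset_separating (X := X) (σ := σ) (by
        intro g
        by_contra! h
        exact hWB (wordBounded_of_list hσ h))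
      exact ⟨A, fun _ => hA⟩
    · exact ⟨∅, fun h => absurd h hσ⟩
  choose A hA using hex
  have : Countable (PolyWord ℕ) := FreeSemigroup.countable
  -- Countability of the set of shapes makes `S` countable, hence `S → ℝ` metrizable. A shape that
  -- succeeds up to distance zero would then contradict the functions in `A σ`.
  let S : Set C(X, ℝ) := ⋃ σ, (A σ : Set C(X, ℝ))
  have : Countable S := (Set.countable_iUnion fun σ => (A σ).countable_toSet).to_subtype
  let φ : C(X, S → ℝ) := ⟨fun x f => f.1 x, by fun_prop⟩
  let _ := TopologicalSpace.metrizableSpaceMetric (S → ℝ)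
  obtain ⟨d, hd, hl, hr, h0⟩ := exists_pseudoMetricSpace_subinvariant φ
  obtain ⟨σ, g, hσ, h⟩ := @exists_list_dist_eq_zero hcov X _ d hd _ hl hr hF
  obtain ⟨x, hx⟩ := hA σ hσ g
  obtain ⟨p, hp, hdp⟩ := h x
  obtain ⟨f, hf, hne⟩ := hx p hp
  exact hne (congrFun (h0 _ _ hdp) ⟨f, Set.mem_iUnion.2 ⟨σ, hf⟩⟩)

theorem mainTheorem2 {X : Type u} [Semigroup X] (hcov : covMeager = Cardinal.continuum.{0})
    (hX : IsZeroClosed X)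
    (h : HasSeparableCompleteSubinvariantMetric X ∨ AdmitsCompactHausdorffSemigroupTopology X) :
    IsPolybounded X := by
  have hF : ∀ F : Filter X, ¬ IsVanishing F := fun F hF => hF.not_isZeroClosed hX
  rcases h with ⟨_, _, _, hd⟩ | ⟨_, _, _, _⟩
  · exact (wordBounded_of_complete_separable hcov (M := X)
      (fun a x y : X => hd a 1 x y (a * x) (a * y) (by simp) (by simp))
      (fun a x y : X => hd 1 a x y (x * a) (y * a) (by simp) (by simp)) hF).isPolybounded
  · exact (wordBounded_of_compact hcov hF).isPolybounded
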